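/- Let $A=(A,\oplus,\neg,0)$ be an MV-algebra, with $1=\neg 0$, $x\ominus y=\neg(\neg x\oplus y)$, $d(x,y)=(x\ominus y)\oplus(y\ominus x)$ and $x\le y$ iff $x\oplus z=y$ for some $z$. An ideal is a subset containing $0$ that is closed under $\oplus$ and downward closed for $\le$; it is proper if it does not contain $1$; an ideal $P$ is prime if $1\notin P$ and, for all $x,y\in A$, $x\ominus y\in P$ or $y\ominus x\in P$. For an ideal $I$, $A/I$ denotes the quotient MV-algebra by the congruence $x\sim y\iff d(x,y)\in I$. Let $Z_A$ be the set of prime ideals of $A$ with the topology that has the sets $W_a=\{P : a\in P\}$, $a\in A$, as a base. Let $E_A=\bigsqcup_{P\in Z_A}A/P$, with the topology that has the sets $\{([a]_P,P) : P\in W_b\}$, $a,b\in A$, as a base. With the projection to $Z_A$, this is an étale space over $Z_A$ whose stalks are the MV-algebras $A/P$, with continuous operations; the resulting sheaf of MV-algebras $\mathsf{Spec}_A=(E_A\to Z_A)$ is the (prime) spectrum sheaf of $A$. **Theorem.** $A$ is hyperarchimedean (that is, for every $a\in A$ there is an integer $n\ge 1$ with $na=(n+1)a$, where $na=a\oplus\cdots\oplus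 a$, $n$ times) if and only if $\mathsf{Spec}_A$ is a Hausdorff sheaf of simple MV-algebras over a Stone space; that is, if and only if the étale space $E_A$ is Hausdorff, every stalk $A/P$ is simple (nontrivial, with $\{0\}$ as its only proper ideal), and $Z_A$ is a Stone space (compact Hausdorff with an open base of clopen sets). -/

import Mathlib

open Set Topology TopologicalSpace

universe u v w

/-- An MV-algebra `(A, ⊕, ¬, 0)`: the operation `⊕` is written `+`, the constant `0` is `0`
(so `(A, +, 0)` is a commutative monoid), and the negation `¬` is `MVAlgebra.neg`. -/
class MVAlgebra (A : Type u) extends AddCommMonoid A where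
  /-- The negation `¬`. -/
  neg : A → A
  neg_neg : ∀ x : A, neg (neg x) = x
  add_neg_zero : ∀ x : A, x + neg 0 = neg 0
  neg_neg_add_add : ∀ x y : A, neg (neg x + y) + y = neg (neg y + x) + x

namespace MVAlgebra

variable {A : Type u} [MVAlgebra A]

/-- The derived constant `1 = ¬ 0`. -/
def top : A := neg 0

/-- The derived operation `x ⊙ y = ¬ (¬ x ⊕ ¬ y)`. -/
def odot (x y : A) : A := neg (neg x + neg y)

/-- The derived operation `x ⊖ y = x ⊙ ¬ y`. -/
def ominus (x y : A) : A := odot x (neg y)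

/-- The distance `d(x, y) = (x ⊖ y) ⊕ (y ⊖ x)`. -/
def dist (x y : A) : A := ominus x y + ominus y x

/-- The natural order: `x ≤ y` iff `x ⊕ z = y` for some `z`. -/
def le (x y : A) : Prop := ∃ z, x + z = y

/-- An element `a` is archimedean if `n a = (n + 1) a` for some integer `n ≥ 1`. -/
def IsArchimedean (a : A) : Prop := ∃ n : ℕ, 1 ≤ n ∧ n • a = (n + 1) • a

variable (A) in
/-- An MV-algebra is hyperarchimedean if all of its elements are archimedean. -/
def IsHyperarchimedean : Prop := ∀ a : A, IsArchimedean a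

section Lemmas

theorem ominus_eq (x y : A) : ominus x y = neg (neg x + y) := by
  simp [ominus, odot, MVAlgebra.neg_neg]

theorem neg_add_self (x : A) : neg x + x = neg 0 := by
  have h := neg_neg_add_add x (neg 0)
  rw [add_neg_zero, MVAlgebra.neg_neg, zero_add] at h
  exact h.symm

theorem le_iff (x y : A) : le x y ↔ neg x + y = neg 0 := by
  constructor
  · rintro ⟨z, rfl⟩
    rw [← add_assoc, neg_add_self, add_comm, add_neg_zero]
  · intro h
    refine ⟨neg (neg y + x), ?_⟩
    have h2 := neg_neg_add_add x y
    rw [h, MVAlgebra.neg_neg, zero_add] at h2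
    rw [add_comm, ← h2]

theorem le_trans' {x y z : A} (h : le x y) (h' : le y z) : le x z := by
  obtain ⟨a, rfl⟩ := h
  obtain ⟨b, rfl⟩ := h'
  exact ⟨a + b, by rw [add_assoc]⟩

theorem add_le_add' {x y z t : A} (h : le x y) (h' : le z t) : le (x + z) (y + t) := by
  obtain ⟨a, rfl⟩ := h
  obtain ⟨b, rfl⟩ := h'
  exact ⟨a + b, by abel⟩

theorem ominus_le_iff (x y z : A) : le (ominus x y) z ↔ le x (y + z) := by
  rw [le_iff, le_iff, ominus_eq, MVAlgebra.neg_neg, add_assoc]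

theorem le_refl' (x : A) : le x x := ⟨0, add_zero x⟩

theorem le_add_ominus (x y : A) : le x (y + ominus x y) :=
  (ominus_le_iff x y _).1 (le_refl' _)

theorem ominus_triangle (x y z : A) : le (ominus x z) (ominus x y + ominus y z) := by
  rw [ominus_le_iff]
  refine le_trans' (le_add_ominus x y) ?_
  have h := add_le_add' (le_add_ominus y z) (le_refl' (ominus x y))
  have e : z + (ominus x y + ominus y z) = z + ominus y z + ominus x y := by abel
  rwa [e]

theorem ominus_add_add (x y z t : A) :
    le (ominus (x + z) (y + t)) (ominus x y + ominus z t) := by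
  rw [ominus_le_iff]
  have h := add_le_add' (le_add_ominus x y) (le_add_ominus z t)
  have e : y + t + (ominus x y + ominus z t) = y + ominus x y + (t + ominus z t) := by abel
  rwa [e]

theorem ominus_neg_neg (x y : A) : ominus (neg x) (neg y) = ominus y x := by
  rw [ominus_eq, ominus_eq, MVAlgebra.neg_neg, add_comm]

theorem ominus_self (x : A) : ominus x x = 0 := by
  rw [ominus_eq, neg_add_self, MVAlgebra.neg_neg]

theorem dist_self (x : A) : dist x x = 0 := by
  rw [dist, ominus_self, add_zero]

theorem dist_comm (x y : A) : dist x y = dist y x := add_comm _ _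

theorem dist_neg_neg (x y : A) : dist (neg x) (neg y) = dist x y := by
  rw [dist, dist, ominus_neg_neg, ominus_neg_neg, add_comm]

theorem dist_triangle (x y z : A) : le (dist x z) (dist x y + dist y z) := by
  have h := add_le_add' (ominus_triangle x y z) (ominus_triangle z y x)
  have e : dist x y + dist y z
      = ominus x y + ominus y z + (ominus z y + ominus y x) := by
    simp only [dist]; abel
  rwa [e]

theorem dist_add_add (x y z t : A) : le (dist (x + z) (y + t)) (dist x y + dist z t) := by
  have h := add_le_add' (ominus_add_add x y z t) (ominus_add_add y x t z)
  have e : dist x y + dist z t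
      = ominus x y + ominus z t + (ominus y x + ominus t z) := by
    simp only [dist]; abel
  rwa [e]

end Lemmas

variable (A) in
/-- Ideals of an MV-algebra. -/
@[ext]
structure MVIdeal where
  /-- The underlying subset. -/
  carrier : Set A
  zero_mem : (0 : A) ∈ carrier
  mem_of_le : ∀ {x y : A}, x ∈ carrier → le y x → y ∈ carrier
  add_mem : ∀ {x y : A}, x ∈ carrier → y ∈ carrier → x + y ∈ carrier

namespace MVIdeal

instance : Membership A (MVIdeal A) := ⟨fun I x => x ∈ I.carrier⟩

/-- A proper ideal is one not containing `1`. -/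
def IsProper (I : MVIdeal A) : Prop := (top : A) ∉ I

/-- Prime ideals: `1 ∉ P`, and for all `x, y` one of `x ⊖ y`, `y ⊖ x` is in `P`. -/
def IsPrime (P : MVIdeal A) : Prop :=
  (top : A) ∉ P ∧ ∀ x y : A, ominus x y ∈ P ∨ ominus y x ∈ P

/-- The congruence of an ideal: `x ∼ y` iff `d(x, y) ∈ I`. -/
def setoid (I : MVIdeal A) : Setoid A where
  r x y := dist x y ∈ I
  iseqv :=
    { refl := fun x => by
        change dist x x ∈ I.carrier
        rw [dist_self]; exact I.zero_mem
      symm := fun {x y} h => by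
        change dist y x ∈ I.carrier
        rw [dist_comm]; exact h
      trans := fun {x y z} h h' => I.mem_of_le (I.add_mem h h') (dist_triangle x y z) }

/-- The quotient `A / I`. -/
def Quot (I : MVIdeal A) : Type u := Quotient I.setoid

/-- The class `[a]_I`. -/
def cls (I : MVIdeal A) (a : A) : I.Quot := Quotient.mk I.setoid a

theorem cls_eq_cls {I : MVIdeal A} {a b : A} : I.cls a = I.cls b ↔ dist a b ∈ I :=
  ⟨fun h => Quotient.exact h, fun h => Quotient.sound h⟩

theorem cls_surjective (I : MVIdeal A) : Function.Surjective I.cls := Quotient.exists_rep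

instance quotAdd (I : MVIdeal A) : Add I.Quot where
  add := Quotient.map₂ (· + ·) fun x y h z t h' =>
    I.mem_of_le (I.add_mem h h') (dist_add_add x y z t)

instance quotZero (I : MVIdeal A) : Zero I.Quot where
  zero := I.cls 0

instance quotMVAlgebra (I : MVIdeal A) : MVAlgebra I.Quot where
  nsmul := nsmulRec
  neg := Quotient.map neg fun x y h => by
    change dist (neg x) (neg y) ∈ I.carrier
    rw [dist_neg_neg]; exact h
  add_assoc := by
    rintro ⟨x⟩ ⟨y⟩ ⟨z⟩; exact congrArg I.cls (add_assoc x y z)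
  zero_add := by rintro ⟨x⟩; exact congrArg I.cls (zero_add x)
  add_zero := by rintro ⟨x⟩; exact congrArg I.cls (add_zero x)
  add_comm := by rintro ⟨x⟩ ⟨y⟩; exact congrArg I.cls (add_comm x y)
  neg_neg := by rintro ⟨x⟩; exact congrArg I.cls (MVAlgebra.neg_neg x)
  add_neg_zero := by rintro ⟨x⟩; exact congrArg I.cls (add_neg_zero x)
  neg_neg_add_add := by rintro ⟨x⟩ ⟨y⟩; exact congrArg I.cls (neg_neg_add_add x y)


end MVIdeal

variable (A) in
/-- An MV-algebra is simple if it is nontrivial and `{0}` is its only proper ideal. -/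
def IsSimple : Prop :=
  (top : A) ≠ 0 ∧ ∀ I : MVIdeal A, I.IsProper → I.carrier = {0}

variable (A) in
/-- The set of prime ideals of `A`, the points of the prime spectral space `Z_A`. -/
@[ext]
structure PrimeSpec where
  /-- The underlying ideal. -/
  ideal : MVIdeal A
  isPrime : ideal.IsPrime

/-- The basic open sets `W_a = {P | a ∈ P}` of the coZariski topology. -/
def W (a : A) : Set (PrimeSpec A) := {P | a ∈ P.ideal}

/-- The coZariski topology on `Z_A`, with base the sets `W_a`. -/
instance : TopologicalSpace (PrimeSpec A) := generateFrom (range (W (A := A)))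

theorem mem_of_add_mem {I : MVIdeal A} {a b : A} (h : a + b ∈ I) : a ∈ I ∧ b ∈ I :=
  ⟨I.mem_of_le h ⟨b, rfl⟩, I.mem_of_le h ⟨a, add_comm b a⟩⟩

theorem W_add (a b : A) : W (a + b) = W a ∩ W b := by
  ext P
  exact ⟨fun h => mem_of_add_mem h, fun h => P.ideal.add_mem h.1 h.2⟩

theorem W_zero : W (0 : A) = univ := by
  ext P
  exact ⟨fun _ => trivial, fun _ => P.ideal.zero_mem⟩

theorem isOpen_W (a : A) : IsOpen (W a) := isOpen_generateFrom_of_mem ⟨a, rfl⟩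

theorem isTopologicalBasis_W : IsTopologicalBasis (range (W (A := A))) where
  exists_subset_inter := by
    rintro _ ⟨a, rfl⟩ _ ⟨b, rfl⟩ P hP
    exact ⟨W (a + b), ⟨_, rfl⟩, by rwa [W_add], (W_add a b).subset⟩
  sUnion_eq := eq_univ_of_forall fun P =>
    mem_sUnion.2 ⟨W 0, ⟨0, rfl⟩, P.ideal.zero_mem⟩
  eq_generateFrom := rfl

/-- The stalk `A / P` over `P ∈ Z_A`. -/
abbrev SpecStalk (P : PrimeSpec A) : Type u := P.ideal.Quot

/-- The section `â : Z_A → E_A`, `â(P) = ([a]_P, P)`, of the disjoint union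
`E_A` of the quotients `A / P`. -/
def hat (a : A) (P : PrimeSpec A) : Σ P : PrimeSpec A, SpecStalk P := ⟨P, P.ideal.cls a⟩

/-- The topology of `E_A`, with base the sets `â(W_b)`. -/
instance specTopology : TopologicalSpace (Σ P : PrimeSpec A, SpecStalk P) :=
  generateFrom {s | ∃ a b : A, s = hat a '' W b}

theorem mem_hat_image {a b : A} {e : Σ P : PrimeSpec A, SpecStalk P} :
    e ∈ hat a '' W b ↔ b ∈ e.1.ideal ∧ e.1.ideal.cls a = e.2 := by
  constructor
  · rintro ⟨P, hP, rfl⟩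
    exact ⟨hP, rfl⟩
  · rintro ⟨h, h'⟩
    obtain ⟨P, x⟩ := e
    exact ⟨P, h, Sigma.ext rfl (heq_of_eq h')⟩

theorem exists_hat (e : Σ P : PrimeSpec A, SpecStalk P) : ∃ a : A, e = hat a e.1 := by
  obtain ⟨P, x⟩ := e
  obtain ⟨a, rfl⟩ := P.ideal.cls_surjective x
  exact ⟨a, rfl⟩

theorem isOpen_hat_image (a b : A) : IsOpen (hat a '' W b) :=
  isOpen_generateFrom_of_mem ⟨a, b, rfl⟩

theorem isTopologicalBasis_hat : IsTopologicalBasis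
    {s : Set (Σ P : PrimeSpec A, SpecStalk P) | ∃ a b : A, s = hat a '' W b} where
  exists_subset_inter := by
    rintro _ ⟨a, b, rfl⟩ _ ⟨c, d, rfl⟩ e ⟨h1, h2⟩
    refine ⟨_, ⟨a, b + d + dist a c, rfl⟩, ?_, fun e' he' => ?_⟩
    · rw [mem_hat_image] at h1 h2 ⊢
      have h3 : dist a c ∈ e.1.ideal := MVIdeal.cls_eq_cls.1 (h1.2.trans h2.2.symm)
      exact ⟨e.1.ideal.add_mem (e.1.ideal.add_mem h1.1 h2.1) h3, h1.2⟩
    · rw [mem_inter_iff, mem_hat_image, mem_hat_image]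
      rw [mem_hat_image] at he'
      obtain ⟨h, hac⟩ := mem_of_add_mem he'.1
      obtain ⟨hb, hd⟩ := mem_of_add_mem h
      exact ⟨⟨hb, he'.2⟩, hd, (MVIdeal.cls_eq_cls.2 hac).symm.trans he'.2⟩
  sUnion_eq := eq_univ_of_forall fun e => by
    obtain ⟨a, ha⟩ := exists_hat e
    exact mem_sUnion.2 ⟨_, ⟨a, 0, rfl⟩, e.1, e.1.ideal.zero_mem, ha.symm⟩
  eq_generateFrom := rfl

theorem continuous_hat (a : A) : Continuous (hat a) := by
  refine continuous_generateFrom_iff.2 ?_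
  rintro _ ⟨c, b, rfl⟩
  have : hat a ⁻¹' (hat c '' W b) = W (b + dist c a) := by
    ext P
    rw [mem_preimage, mem_hat_image, W_add]
    exact and_congr Iff.rfl MVIdeal.cls_eq_cls
  rw [this]
  exact isOpen_W _

theorem isOpenEmbedding_hat (a : A) : IsOpenEmbedding (hat a) := by
  refine .of_continuous_injective_isOpenMap (continuous_hat a)
    (fun P Q h => congrArg Sigma.fst h) ?_
  refine isTopologicalBasis_W.isOpenMap_iff.2 ?_
  rintro _ ⟨b, rfl⟩
  exact isOpen_hat_image a b

theorem isLocalHomeomorph_fst :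
    IsLocalHomeomorph (Sigma.fst : (Σ P : PrimeSpec A, SpecStalk P) → PrimeSpec A) := by
  refine IsLocalHomeomorph.mk _ fun e => ?_
  obtain ⟨a, ha⟩ := exists_hat e
  have : Nonempty (PrimeSpec A) := ⟨e.1⟩
  let φ := (isOpenEmbedding_hat a).toOpenPartialHomeomorph (hat a)
  refine ⟨φ.symm, ?_, ?_⟩
  · change e ∈ φ.target
    rw [IsOpenEmbedding.toOpenPartialHomeomorph_target]
    exact ⟨e.1, ha.symm⟩
  · intro e' he'
    change e' ∈ φ.target at he'
    rw [IsOpenEmbedding.toOpenPartialHomeomorph_target] at he'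
    obtain ⟨P, rfl⟩ := he'
    exact ((isOpenEmbedding_hat a).toOpenPartialHomeomorph_left_inv (hat a)).symm

theorem continuous_spec_neg : Continuous
    (fun e : Σ P : PrimeSpec A, SpecStalk P =>
      (⟨e.1, neg e.2⟩ : Σ P : PrimeSpec A, SpecStalk P)) := by
  refine continuous_iff_continuousAt.2 fun e => ?_
  obtain ⟨a, ha⟩ := exists_hat e
  rw [ha]
  have h : ContinuousAt (hat (neg a)) e.1 := (continuous_hat (neg a)).continuousAt
  exact (isOpenEmbedding_hat a).continuousAt_iff.1 h

/-- The fibre product `E ×_X E` of the disjoint union `E` of the sets `F x` over `X`. -/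
def FiberSquare {X : Type v} (F : X → Type w) : Type (max v w) := Σ x, F x × F x

/-- The fibre product `E ×_X E` has the topology induced from `E × E`. -/
instance {X : Type v} (F : X → Type w) [TopologicalSpace (Σ x, F x)] :
    TopologicalSpace (FiberSquare F) :=
  induced (fun p : FiberSquare F =>
    ((⟨p.1, p.2.1⟩ : Σ x, F x), (⟨p.1, p.2.2⟩ : Σ x, F x))) inferInstance

theorem continuous_spec_add : Continuous
    (fun p : FiberSquare (SpecStalk (A := A)) =>
      (⟨p.1, p.2.1 + p.2.2⟩ : Σ P : PrimeSpec A, SpecStalk P)) := by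
  have hind : Continuous (fun p : FiberSquare (SpecStalk (A := A)) =>
      ((⟨p.1, p.2.1⟩ : Σ P : PrimeSpec A, SpecStalk P),
        (⟨p.1, p.2.2⟩ : Σ P : PrimeSpec A, SpecStalk P))) := continuous_induced_dom
  have hfst : Continuous (fun p : FiberSquare (SpecStalk (A := A)) => p.1) :=
    isLocalHomeomorph_fst.continuous.comp (continuous_fst.comp hind)
  refine continuous_iff_continuousAt.2 fun p => ?_
  obtain ⟨P, x, y⟩ := p
  obtain ⟨a, rfl⟩ := P.ideal.cls_surjective x
  obtain ⟨b, rfl⟩ := P.ideal.cls_surjective y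
  have h1 := ((isOpen_hat_image a 0).preimage (continuous_fst.comp hind))
  have h2 := ((isOpen_hat_image b 0).preimage (continuous_snd.comp hind))
  refine ((continuous_hat (a + b)).comp hfst).continuousAt.congr ?_
  filter_upwards [h1.mem_nhds (mem_hat_image.2 ⟨P.ideal.zero_mem, rfl⟩),
    h2.mem_nhds (mem_hat_image.2 ⟨P.ideal.zero_mem, rfl⟩)] with q hq1 hq2
  have e1 := (mem_hat_image.1 hq1).2
  have e2 := (mem_hat_image.1 hq2).2
  refine Sigma.ext rfl (heq_of_eq ?_)
  exact congrArg₂ (fun s t : SpecStalk q.1 => s + t) e1 e2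

/-- A sheaf of MV-algebras on a space `X`, given as an étale space over `X`: a family of stalks
`E_x`, a topology on their disjoint union `E` for which the projection `E → X` is a local
homeomorphism, and MV-algebra structures on the stalks such that the operations
`0 : X → E`, `¬ : E → E` and `⊕ : E ×_X E → E` are continuous. -/
structure MVSheaf (X : Type v) [TopologicalSpace X] where
  /-- The stalks `E_x`. -/
  Stalk : X → Type w
  /-- The MV-algebra structure of the stalks. -/
  [stalkMVAlgebra : ∀ x, MVAlgebra (Stalk x)]
  /-- The topology of the étale space `E`. -/
  [totalTopology : TopologicalSpace (Σ x, Stalk x)]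
  isLocalHomeomorph_proj : IsLocalHomeomorph (Sigma.fst : (Σ x, Stalk x) → X)
  continuous_zero : Continuous (fun x => (⟨x, 0⟩ : Σ x, Stalk x))
  continuous_neg : Continuous
    (fun e : Σ x, Stalk x => (⟨e.1, neg e.2⟩ : Σ x, Stalk x))
  continuous_add : Continuous
    (fun p : FiberSquare Stalk => (⟨p.1, p.2.1 + p.2.2⟩ : Σ x, Stalk x))

namespace MVSheaf

variable {X : Type v} [TopologicalSpace X]

attribute [instance] stalkMVAlgebra totalTopology

/-- A sheaf is Hausdorff if its étale space `E` is a Hausdorff space. -/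
def IsHausdorff (E : MVSheaf.{v, w} X) : Prop := T2Space (Σ x, E.Stalk x)

/-- A sheaf of simple MV-algebras: all stalks are simple. -/
def HasSimpleStalks (E : MVSheaf.{v, w} X) : Prop := ∀ x, IsSimple (E.Stalk x)

end MVSheaf

variable (A) in
/-- The prime spectrum sheaf `Spec_A = (E_A → Z_A)`. -/
def spectrumSheaf : MVSheaf.{u, u} (PrimeSpec A) where
  Stalk := SpecStalk
  isLocalHomeomorph_proj := isLocalHomeomorph_fst
  continuous_zero := continuous_hat 0
  continuous_neg := continuous_spec_neg
  continuous_add := continuous_spec_add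

/-- A Stone space: compact Hausdorff with an open base of clopen sets. -/
def IsStoneSpace (X : Type v) [TopologicalSpace X] : Prop :=
  CompactSpace X ∧ T2Space X ∧ IsTopologicalBasis {s : Set X | IsClopen s}

end MVAlgebra

/-! The equation `n a = (n + 1) a` forces `a ∧ ¬(n a) = 0`, and a prime ideal contains one of any
two disjoint elements. So for each prime `P` either `a ∈ P`, or `n a ≡ 1` modulo `P`
(`isDisjoint_neg_nsmul`, `IsPrime.mem_or_mem_of_isDisjoint`). This alternative makes each stalk
simple and makes `W a` clopen, with complement `W (¬(n a))`. Clopen sets `W a` separate primes, and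
also separate germs, since two sections agree exactly on some `W (d(a, b))`. Compactness of `Z_A`
holds for every `A`, by ultrafilter limits.

Conversely, simple stalks give at each `P` either `a ∈ P` or some `n` with `¬(n a) ∈ P`. By
compactness one `N` serves all `P`; then `(N + 1) a ⊖ N a` lies in every prime, so it is `0` because
the primes intersect in `{0}` (`exists_isPrime_notMem`). -/

namespace MVAlgebra

/-! ### Order, meets and disjointness -/

section Order

variable {A : Type u} [MVAlgebra A]

theorem zero_le' (x : A) : le 0 x := ⟨x, zero_add x⟩

theorem le_add_left' (x y : A) : le x (y + x) := ⟨y, add_comm x y⟩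

theorem le_add_right' (x y : A) : le x (x + y) := ⟨y, rfl⟩

theorem le_top (x : A) : le x top := ⟨top, add_neg_zero x⟩

theorem neg_top : neg (top : A) = 0 := MVAlgebra.neg_neg 0

theorem le_antisymm' {x y : A} (h : le x y) (h' : le y x) : x = y := by
  have e := neg_neg_add_add x y
  rw [(le_iff x y).1 h, (le_iff y x).1 h', MVAlgebra.neg_neg, zero_add, zero_add] at e
  exact e.symm

theorem eq_zero_of_le_zero {x : A} (h : le x 0) : x = 0 := le_antisymm' h (zero_le' x)

theorem eq_top_of_top_le {x : A} (h : le top x) : x = top := le_antisymm' (le_top x) h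

theorem ominus_eq_zero_iff {x y : A} : ominus x y = 0 ↔ le x y := by
  constructor
  · intro h
    have := le_add_ominus x y
    rwa [h, add_zero] at this
  · intro h
    exact eq_zero_of_le_zero ((ominus_le_iff x y 0).2 (by rwa [add_zero]))

theorem ominus_le (x y : A) : le (ominus x y) x :=
  (ominus_le_iff x y x).2 (le_add_left' x y)

theorem ominus_le_neg (x y : A) : le (ominus x y) (neg y) := by
  rw [ominus_le_iff, add_comm, neg_add_self]
  exact le_top x

theorem ominus_zero (x : A) : ominus x 0 = x := by
  rw [ominus_eq, add_zero, MVAlgebra.neg_neg]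

theorem zero_ominus (x : A) : ominus 0 x = 0 := ominus_eq_zero_iff.2 (zero_le' x)

theorem dist_zero_right (x : A) : dist x 0 = x := by
  rw [dist, ominus_zero, zero_ominus, add_zero]

theorem dist_top_left (x : A) : dist top x = neg x := by
  rw [← dist_neg_neg, neg_top, dist_comm, dist_zero_right]

theorem ominus_add_cancel {x y : A} (h : le y x) : ominus x y + y = x := by
  rw [ominus_eq, neg_neg_add_add, (le_iff y x).1 h, MVAlgebra.neg_neg, zero_add]

/-- The bound `c ≤ ¬t` says that the truncated sum `t ⊕ c` loses nothing. -/
theorem add_ominus_cancel {t c : A} (h : le c (neg t)) : ominus (t + c) t = c := by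
  have e := neg_neg_add_add (neg c) t
  rw [MVAlgebra.neg_neg, add_comm (neg t), (le_iff c (neg t)).1 h, MVAlgebra.neg_neg, zero_add,
    add_comm c t] at e
  rw [ominus_eq, e, MVAlgebra.neg_neg]

/-- Both sides are the meet `x ∧ y`; the symmetry is the last MV-axiom applied to `¬y` and `¬x`. -/
theorem ominus_ominus_comm (x y : A) : ominus x (ominus x y) = ominus y (ominus y x) := by
  have e := neg_neg_add_add (neg y) (neg x)
  rw [MVAlgebra.neg_neg, MVAlgebra.neg_neg] at e
  simp only [ominus_eq]
  rw [add_comm (neg x) (neg _), add_comm (neg x) y, e, add_comm x (neg y), add_comm (neg y) (neg _)]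

theorem ominus_le_ominus_left {y z : A} (x : A) (h : le y z) : le (ominus x z) (ominus x y) :=
  (ominus_le_iff x z _).2
    (le_trans' (le_add_ominus x y) (add_le_add' h (le_refl' _)))

theorem le_ominus_ominus {s x y : A} (hx : le s x) (hy : le s y) :
    le s (ominus x (ominus x y)) := by
  have h := ominus_le_ominus_left x (ominus_le_ominus_left x hy)
  rwa [ominus_ominus_comm x s, ominus_eq_zero_iff.2 hx, ominus_zero] at h

/-- Two elements are disjoint if `0` is their only common lower bound. -/
def IsDisjoint (x y : A) : Prop := ∀ c : A, le c x → le c y → c = 0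

theorem IsDisjoint.symm {x y : A} (h : IsDisjoint x y) : IsDisjoint y x :=
  fun c hy hx => h c hx hy

/-- With `t = x ∧ y`, one has `x = t ⊕ (x ⊖ y)` and `y = t ⊕ (y ⊖ x)`. A common lower bound `c`
gives `t ⊕ c ≤ x ∧ y = t`, and `c ≤ ¬t` allows cancellation. -/
theorem isDisjoint_ominus (x y : A) : IsDisjoint (ominus x y) (ominus y x) := by
  intro c hxy hyx
  have hx : ominus x (ominus x y) + ominus x y = x := ominus_add_cancel (ominus_le x y)
  have hy : ominus x (ominus x y) + ominus y x = y := by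
    rw [ominus_ominus_comm]; exact ominus_add_cancel (ominus_le y x)
  generalize ht : ominus x (ominus x y) = t at hx hy
  have h1 : le (t + c) x := by
    conv_rhs => rw [← hx]
    exact add_le_add' (le_refl' t) hxy
  have h2 : le (t + c) y := by
    conv_rhs => rw [← hy]
    exact add_le_add' (le_refl' t) hyx
  have h3 : le (t + c) t := by
    have := le_ominus_ominus h1 h2
    rwa [ht] at this
  have h4 : le c (neg t) := by
    refine le_trans' hxy ?_
    rw [← ht, ominus_eq x (ominus x y), MVAlgebra.neg_neg]
    exact le_add_left' _ _
  rw [← add_ominus_cancel h4]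
  exact ominus_eq_zero_iff.2 h3

theorem IsDisjoint.add_right {x y z : A} (hy : IsDisjoint x y) (hz : IsDisjoint x z) :
    IsDisjoint x (y + z) := fun c hx hc =>
  hz c hx (ominus_eq_zero_iff.1
    (hy _ (le_trans' (ominus_le c z) hx) ((ominus_le_iff c z y).2 (by rwa [add_comm]))))

theorem IsDisjoint.nsmul_right {x y : A} (h : IsDisjoint x y) (n : ℕ) :
    IsDisjoint x (n • y) := by
  induction n with
  | zero => rw [zero_nsmul]; exact fun c _ hc => eq_zero_of_le_zero hc
  | succ n ih => rw [succ_nsmul]; exact ih.add_right h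

theorem IsDisjoint.ominus_eq_left {x y : A} (h : IsDisjoint x y) : ominus x y = x := by
  have h0 : ominus x (ominus x y) = 0 :=
    h _ (ominus_le _ _) (by rw [ominus_ominus_comm]; exact ominus_le _ _)
  exact le_antisymm' (ominus_le x y) (ominus_eq_zero_iff.1 h0)

theorem nsmul_le_nsmul_of_le {m n : ℕ} (h : m ≤ n) (x : A) : le (m • x) (n • x) := by
  obtain ⟨k, rfl⟩ := Nat.exists_eq_add_of_le h
  exact ⟨k • x, (add_nsmul x m k).symm⟩

/-- `n a = (n + 1) a` says that the meet of `a` and `¬ (n a)` is zero. -/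
theorem isDisjoint_neg_nsmul {a : A} {n : ℕ} (h : n • a = (n + 1) • a) :
    IsDisjoint a (neg (n • a)) := by
  intro c hc hn
  -- Since `c ≤ ¬(n a)`, `c = (n a ⊕ c) ⊖ n a`, while `n a ⊕ c ≤ n a ⊕ a = n a`.
  rw [← add_ominus_cancel hn]
  refine ominus_eq_zero_iff.2 ?_
  conv_rhs => rw [h, succ_nsmul]
  exact add_le_add' (le_refl' _) hc

end Order

/-! ### Ideals, prime ideals and simple quotients -/

section Ideals

variable {A : Type u} [MVAlgebra A]

namespace MVIdeal

variable (A) in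
/-- The ideal `{0}`. -/
def zeroIdeal : MVIdeal A where
  carrier := {0}
  zero_mem := rfl
  mem_of_le := by rintro x y rfl h; exact eq_zero_of_le_zero h
  add_mem := by rintro x y rfl rfl; exact add_zero 0

/-- The ideal generated by an ideal `I` and an element `u`. -/
def adjoin (I : MVIdeal A) (u : A) : MVIdeal A where
  carrier := {x | ∃ i ∈ I, ∃ n : ℕ, le x (i + n • u)}
  zero_mem := ⟨0, I.zero_mem, 0, zero_le' _⟩
  mem_of_le := fun ⟨i, hi, n, h⟩ h' => ⟨i, hi, n, le_trans' h' h⟩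
  add_mem := fun {x y} ⟨i, hi, n, h⟩ ⟨j, hj, m, h'⟩ => by
    refine ⟨i + j, I.add_mem hi hj, n + m, ?_⟩
    have e : i + j + (n + m) • u = (i + n • u) + (j + m • u) := by rw [add_nsmul]; abel
    rw [e]
    exact add_le_add' h h'

theorem mem_adjoin_of_mem {I : MVIdeal A} {x : A} (u : A) (h : x ∈ I) : x ∈ I.adjoin u :=
  ⟨x, h, 0, le_add_right' _ _⟩

theorem self_mem_adjoin (I : MVIdeal A) (u : A) : u ∈ I.adjoin u :=
  ⟨0, I.zero_mem, 1, by rw [one_nsmul]; exact le_add_left' _ _⟩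

theorem nsmul_mem {I : MVIdeal A} {x : A} (h : x ∈ I) (n : ℕ) : n • x ∈ I := by
  induction n with
  | zero => rw [zero_nsmul]; exact I.zero_mem
  | succ n ih => rw [succ_nsmul]; exact I.add_mem ih h

theorem cls_nsmul (I : MVIdeal A) (n : ℕ) (a : A) : I.cls (n • a) = n • I.cls a := by
  induction n with
  | zero => rw [zero_nsmul, zero_nsmul]; rfl
  | succ n ih => rw [succ_nsmul, succ_nsmul, ← ih]; rfl

theorem cls_eq_zero_iff {I : MVIdeal A} {a : A} : I.cls a = 0 ↔ a ∈ I := by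
  change I.cls a = I.cls 0 ↔ _
  rw [cls_eq_cls, dist_zero_right]

theorem cls_eq_top_iff {I : MVIdeal A} {a : A} : I.cls a = top ↔ neg a ∈ I := by
  change I.cls a = I.cls top ↔ _
  rw [cls_eq_cls, dist_comm, dist_top_left]

theorem IsPrime.mem_or_mem_of_isDisjoint {P : MVIdeal A} (hP : P.IsPrime) {x y : A}
    (h : IsDisjoint x y) : x ∈ P ∨ y ∈ P := by
  have := hP.2 x y
  rwa [h.ominus_eq_left, h.symm.ominus_eq_left] at this

theorem IsPrime.neg_notMem {P : MVIdeal A} (hP : P.IsPrime) {x : A} (h : x ∈ P) :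
    neg x ∉ P := fun h' => hP.1 (by
  have := P.add_mem h' h
  rwa [neg_add_self] at this)

theorem exists_isMax_notMem {z : A} (hz : z ≠ 0) :
    ∃ M : MVIdeal A, z ∉ M ∧
      ∀ J : MVIdeal A, M.carrier ⊆ J.carrier → z ∉ J → J.carrier ⊆ M.carrier := by
  obtain ⟨m, hm⟩ := zorn_subset {s : Set A | ∃ I : MVIdeal A, I.carrier = s ∧ z ∉ I} (by
    intro c hc hchain
    rcases c.eq_empty_or_nonempty with rfl | ⟨s₀, hs₀⟩
    -- The empty chain is bounded by `{0}`, which avoids `z` because `z ≠ 0`.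
    · exact ⟨{0}, ⟨zeroIdeal A, rfl, hz⟩, by simp⟩
    refine ⟨⋃₀ c, ⟨⟨⋃₀ c, ?_, ?_, ?_⟩, rfl, ?_⟩, fun s hs => subset_sUnion_of_mem hs⟩
    · obtain ⟨I, hI, -⟩ := hc hs₀
      exact ⟨s₀, hs₀, hI ▸ I.zero_mem⟩
    · rintro x y ⟨s, hs, hx⟩ hy
      obtain ⟨I, rfl, -⟩ := hc hs
      exact ⟨_, hs, I.mem_of_le hx hy⟩
    · rintro x y ⟨s, hs, hx⟩ ⟨t, ht, hy⟩
      rcases hchain.total hs ht with h | h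
      · obtain ⟨I, rfl, -⟩ := hc ht
        exact ⟨_, ht, I.add_mem (h hx) hy⟩
      · obtain ⟨I, rfl, -⟩ := hc hs
        exact ⟨_, hs, I.add_mem hx (h hy)⟩
    · rintro ⟨s, hs, hx⟩
      obtain ⟨I, rfl, hI⟩ := hc hs
      exact hI hx)
  obtain ⟨M, rfl, hM⟩ := hm.prop
  exact ⟨M, hM, fun J hMJ hJ => hm.le_of_ge ⟨J, rfl, hJ⟩ hMJ⟩

/-- Every nonzero element is outside some prime ideal. -/
theorem exists_isPrime_notMem {z : A} (hz : z ≠ 0) : ∃ P : MVIdeal A, P.IsPrime ∧ z ∉ P := by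
  obtain ⟨M, hzM, hmax⟩ := exists_isMax_notMem hz
  have key : ∀ u : A, u ∉ M → ∃ i ∈ M, ∃ n : ℕ, le z (i + n • u) := by
    intro u hu
    by_contra h
    exact hu (hmax (M.adjoin u) (fun x hx => mem_adjoin_of_mem u hx) h (M.self_mem_adjoin u))
  refine ⟨M, ⟨fun h => hzM (M.mem_of_le h (le_top z)), fun x y => ?_⟩, hzM⟩
  by_contra! hxy
  obtain ⟨i, hi, n, hn⟩ := key _ hxy.1
  obtain ⟨j, hj, m, hm⟩ := key _ hxy.2
  -- Disjointness passes to multiples, and `z ⊖ (i ⊕ j)` lies below both of them; hence it is `0`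
  -- and `z ≤ i ⊕ j ∈ M`.
  have hd : IsDisjoint (n • ominus x y) (m • ominus y x) :=
    (((isDisjoint_ominus x y).nsmul_right m).symm.nsmul_right n).symm
  have h0 := hd (ominus z (i + j))
    ((ominus_le_iff _ _ _).2 (le_trans' hn (add_le_add' (le_add_right' i j) (le_refl' _))))
    ((ominus_le_iff _ _ _).2 (le_trans' hm (add_le_add' (le_add_left' j i) (le_refl' _))))
  exact hzM (M.mem_of_le (M.add_mem hi hj) (ominus_eq_zero_iff.1 h0))

/-- In a simple quotient, every nonzero class has a multiple equal to `1`. -/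
theorem exists_neg_nsmul_mem_of_isSimple {I : MVIdeal A} (hI : IsSimple I.Quot) {a : A}
    (ha : a ∉ I) : ∃ n : ℕ, neg (n • a) ∈ I := by
  have hne : I.cls a ≠ 0 := fun h => ha (cls_eq_zero_iff.1 h)
  have htop : top ∈ (zeroIdeal I.Quot).adjoin (I.cls a) := by
    by_contra h
    have := self_mem_adjoin (zeroIdeal I.Quot) (I.cls a)
    change I.cls a ∈ ((zeroIdeal I.Quot).adjoin (I.cls a)).carrier at this
    rw [hI.2 _ h] at this
    exact hne this
  obtain ⟨i, rfl, n, hn⟩ := htop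
  rw [zero_add, ← cls_nsmul] at hn
  exact ⟨n, cls_eq_top_iff.1 (eq_top_of_top_le hn)⟩

/-- The quotient of a hyperarchimedean MV-algebra by a prime ideal is simple. -/
theorem IsPrime.isSimple_quot {P : MVIdeal A} (hP : P.IsPrime) (hA : IsHyperarchimedean A) :
    IsSimple P.Quot := by
  refine ⟨fun h => hP.1 (cls_eq_zero_iff.1 h), fun I hI => ?_⟩
  refine Subset.antisymm (fun x hx => ?_) (singleton_subset_iff.2 I.zero_mem)
  obtain ⟨a, rfl⟩ := P.cls_surjective x
  obtain ⟨n, -, hn⟩ := hA a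
  rcases hP.mem_or_mem_of_isDisjoint (isDisjoint_neg_nsmul hn) with h | h
  · exact cls_eq_zero_iff.2 h
  -- Here the class of `n a` is `1`, so an ideal containing the class of `a` is not proper.
  · refine absurd ?_ hI
    rw [← cls_eq_top_iff.2 h, cls_nsmul]
    exact nsmul_mem hx n

end MVIdeal

end Ideals

/-! ### Topology of the spectrum and of the étale space -/

section Spectrum

variable {A : Type u} [MVAlgebra A]

/-- The limit of an ultrafilter on the prime spectrum: the `a` with `W a` in the ultrafilter. -/
def PrimeSpec.ofUltrafilter (F : Ultrafilter (PrimeSpec A)) : PrimeSpec A where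
  ideal :=
    { carrier := {a | W a ∈ F}
      zero_mem := by
        change W 0 ∈ F
        rw [W_zero]; exact Filter.univ_mem
      mem_of_le := fun h hle =>
        Filter.mem_of_superset h fun P hP => P.ideal.mem_of_le hP hle
      add_mem := fun {x y} h h' => by
        change W (x + y) ∈ F
        rw [W_add]; exact Filter.inter_mem h h' }
  isPrime := by
    refine ⟨fun h => ?_, fun x y => ?_⟩
    · obtain ⟨P, hP⟩ := F.nonempty_of_mem h
      exact P.isPrime.1 hP
    · exact Ultrafilter.union_mem_iff.1
        (Filter.mem_of_superset Filter.univ_mem fun P _ => P.isPrime.2 x y)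

/-- An ultrafilter converges to its limit ideal by construction: the subbasic neighbourhoods `W a`
of that ideal are those belonging to the ultrafilter. -/
instance : CompactSpace (PrimeSpec A) := by
  refine ⟨isCompact_iff_ultrafilter_le_nhds.2 fun F _ => ⟨PrimeSpec.ofUltrafilter F, trivial, ?_⟩⟩
  rw [nhds_generateFrom]
  refine le_iInf₂ fun s hs => ?_
  obtain ⟨hP, a, rfl⟩ := hs
  exact Filter.le_principal_iff.2 hP

theorem compl_W_of_nsmul_eq {a : A} {n : ℕ} (h : n • a = (n + 1) • a) :
    (W a)ᶜ = W (neg (n • a)) := by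
  ext P
  constructor
  · exact (P.isPrime.mem_or_mem_of_isDisjoint (isDisjoint_neg_nsmul h)).resolve_left
  · exact fun hP ha => P.isPrime.neg_notMem (MVIdeal.nsmul_mem ha n) hP

theorem IsHyperarchimedean.isClopen_W (hA : IsHyperarchimedean A) (a : A) : IsClopen (W a) := by
  obtain ⟨n, -, hn⟩ := hA a
  exact ⟨⟨compl_W_of_nsmul_eq hn ▸ isOpen_W _⟩, isOpen_W a⟩

/-- A prime is determined by the sets `W a` containing it, so the diagonal is an intersection of
closed sets. -/
theorem t2Space_of_isClopen_W (h : ∀ a : A, IsClopen (W a)) : T2Space (PrimeSpec A) := by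
  refine t2_iff_isClosed_diagonal.2 ?_
  have : diagonal (PrimeSpec A) =
      ⋂ a : A, {p | p.1 ∈ W a ↔ p.2 ∈ W a} := by
    ext ⟨P, Q⟩
    simp only [mem_diagonal_iff, mem_iInter, mem_ofPred_eq]
    exact ⟨fun e a => e ▸ Iff.rfl, fun e => PrimeSpec.ext (MVIdeal.ext (Set.ext e))⟩
  rw [this]
  refine isClosed_iInter fun a => ?_
  have h1 : IsClopen {p : PrimeSpec A × PrimeSpec A | p.1 ∈ W a} := (h a).preimage continuous_fst
  have h2 : IsClopen {p : PrimeSpec A × PrimeSpec A | p.2 ∈ W a} := (h a).preimage continuous_snd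
  have e : {p : PrimeSpec A × PrimeSpec A | p.1 ∈ W a ↔ p.2 ∈ W a} =
      ({p | p.1 ∈ W a}ᶜ ∪ {p | p.2 ∈ W a}) ∩ ({p | p.2 ∈ W a}ᶜ ∪ {p | p.1 ∈ W a}) := by
    ext p
    simp only [mem_ofPred_eq, mem_inter_iff, mem_union, mem_compl_iff]
    tauto
  rw [e]
  exact ((h1.compl.union h2).inter (h2.compl.union h1)).1

theorem IsHyperarchimedean.isStoneSpace (hA : IsHyperarchimedean A) :
    IsStoneSpace (PrimeSpec A) := by
  refine ⟨inferInstance, t2Space_of_isClopen_W hA.isClopen_W, ?_⟩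
  refine isTopologicalBasis_of_isOpen_of_nhds (fun s hs => hs.2) fun P U hP hU => ?_
  obtain ⟨_, ⟨a, rfl⟩, ha, haU⟩ := isTopologicalBasis_W.exists_subset_of_mem_open hP hU
  exact ⟨W a, hA.isClopen_W a, ha, haU⟩

/-- Points over distinct primes are separated in the base. Over one prime, `[a]` and `[b]` are
separated by the two sections restricted to the open complement of `W (d(a, b))`, where they differ
everywhere. -/
theorem t2Space_total_of_isClopen_W (h : ∀ a : A, IsClopen (W a)) :
    T2Space (Σ P : PrimeSpec A, SpecStalk P) := by
  have := t2Space_of_isClopen_W h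
  have hπ : Continuous (Sigma.fst : (Σ P : PrimeSpec A, SpecStalk P) → PrimeSpec A) :=
    isLocalHomeomorph_fst.continuous
  refine ⟨fun e e' hne => ?_⟩
  by_cases hfst : e.1 = e'.1
  · obtain ⟨a, ha⟩ := exists_hat e
    obtain ⟨b, hb⟩ := exists_hat e'
    rw [← hfst] at hb
    have hab : dist a b ∉ e.1.ideal := fun hd =>
      hne (by rw [ha, hb, hat, hat, MVIdeal.cls_eq_cls.2 hd])
    refine ⟨hat a '' (W (dist a b))ᶜ, hat b '' (W (dist a b))ᶜ,
      (isOpenEmbedding_hat a).isOpenMap _ (h _).compl.isOpen,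
      (isOpenEmbedding_hat b).isOpenMap _ (h _).compl.isOpen,
      ⟨e.1, hab, ha.symm⟩, ⟨e.1, hab, hb.symm⟩, ?_⟩
    rw [disjoint_left]
    rintro _ ⟨P, hP, rfl⟩ ⟨Q, -, hQ⟩
    obtain rfl : Q = P := congrArg Sigma.fst hQ
    exact hP (MVIdeal.cls_eq_cls.1 (eq_of_heq (Sigma.mk.inj hQ).2).symm)
  · obtain ⟨U, V, hU, hV, heU, heV, hd⟩ := t2_separation hfst
    exact ⟨_, _, hU.preimage hπ, hV.preimage hπ, heU, heV, hd.preimage _⟩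

/-- An MV-algebra whose quotients by prime ideals are simple is hyperarchimedean. -/
theorem isHyperarchimedean_of_isSimple (h : ∀ P : PrimeSpec A, IsSimple P.ideal.Quot) :
    IsHyperarchimedean A := by
  intro a
  have hcover : (univ : Set (PrimeSpec A)) ⊆ ⋃ n : ℕ, W a ∪ W (neg (n • a)) := by
    intro P _
    by_cases ha : a ∈ P.ideal
    · exact mem_iUnion.2 ⟨0, Or.inl ha⟩
    · obtain ⟨n, hn⟩ := MVIdeal.exists_neg_nsmul_mem_of_isSimple (h P) ha
      exact mem_iUnion.2 ⟨n, Or.inr hn⟩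
  obtain ⟨s, hs⟩ := isCompact_univ.elim_finite_subcover _
    (fun n => (isOpen_W a).union (isOpen_W (neg (n • a)))) hcover
  -- `N` bounds all indices of the finite subcover; the `+ 1` secures `N ≥ 1`.
  let N := s.sup id + 1
  have hN : ∀ P : PrimeSpec A, ominus ((N + 1) • a) (N • a) ∈ P.ideal := by
    intro P
    obtain ⟨n, hn, hP⟩ := mem_iUnion₂.1 (hs (mem_univ P))
    rcases hP with hP | hP
    · exact P.ideal.mem_of_le (MVIdeal.nsmul_mem hP (N + 1)) (ominus_le _ _)
    -- Here `(N + 1) a ⊖ N a ≤ ¬(N a) ≤ ¬(n a) ∈ P`.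
    · have hnN : n ≤ N := (Finset.le_sup (f := id) hn).trans (Nat.le_succ _)
      refine P.ideal.mem_of_le hP (le_trans' (ominus_le_neg _ _) ?_)
      rw [le_iff, MVAlgebra.neg_neg, add_comm]
      exact (le_iff _ _).1 (nsmul_le_nsmul_of_le hnN a)
  refine ⟨N, Nat.le_add_left 1 _,
    le_antisymm' (nsmul_le_nsmul_of_le (Nat.le_succ N) a) (ominus_eq_zero_iff.1 ?_)⟩
  by_contra hne
  obtain ⟨P, hP, hmem⟩ := MVIdeal.exists_isPrime_notMem hne
  exact hmem (hN ⟨P, hP⟩)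

end Spectrum

end MVAlgebra

/-- An MV-algebra `A` is hyperarchimedean if and only if its spectrum sheaf is a Hausdorff sheaf
of simple MV-algebras over a Stone space. -/
theorem theorem5 {A : Type u} [MVAlgebra A] :
    MVAlgebra.IsHyperarchimedean A ↔
      ((MVAlgebra.spectrumSheaf A).IsHausdorff ∧
        (MVAlgebra.spectrumSheaf A).HasSimpleStalks ∧
        MVAlgebra.IsStoneSpace (MVAlgebra.PrimeSpec A)) :=
  ⟨fun hA => ⟨MVAlgebra.t2Space_total_of_isClopen_W hA.isClopen_W,
    fun P => P.isPrime.isSimple_quot hA, hA.isStoneSpace⟩,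
    fun h => MVAlgebra.isHyperarchimedean_of_isSimple h.2.1⟩
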